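/- Let $\mathbb N=\{1,2,3,\dots\}$. For a subset $S$ of a group $G$ and $k\ge 0$ let $S^k=\{s_1s_2\cdots s_k : s_1,\dots,s_k\in S\}$. A group $G$ is \emph{strongly distorted} if there exist an integer $m\ge 0$ and a sequence $(w_n)_{n\in\mathbb N}$ of non-negative integers such that for every sequence $(g_n)_{n\in\mathbb N}$ in $G$ there is a subset $S\subset G$ of cardinality at most $m$ with $g_n\in S^{w_n}$ for all $n\in\mathbb N$. Let $\alpha$ be an ordinal, let $\omega^{\alpha+1}$ (ordinal exponentiation) carry the order topology, and let $\mathrm{Homeo}(\omega^{\alpha+1})$ be its group of self-homeomorphisms. Then $\mathrm{Homeo}(\omega^{\alpha+1})$ is strongly distorted. Explicitly, for every sequence $(h_n)_{n\in\mathbb N}$ in $\mathrm{Homeo}(\omega^{\alpha+1})$ there is a set $S\subset\mathrm{Homeo}(\omega^{\alpha+1})$ with exactly four elements such that, for every $n\in\mathbb N$, $h_n$ is a word of length at most $12n+18$ in the elements of $S$ and their inverses, i.e. $h_n=x_1x_2\cdots x_k$ with $k\le 12n+18$ and each $x_i\in S\cup S^{-1}$. -/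

import Mathlib

open Ordinal Topology
open scoped Pointwise

universe u v

/-- The ordinal `o` as a space: the set of ordinals below `o` with its order topology. (The subspace
topology it inherits from `Ordinal` is the order topology, see `ordinalSpace_orderTopology`.) -/
abbrev OrdinalSpace (o : Ordinal.{u}) : Type (u + 1) := Set.Iio o

theorem ordinalSpace_orderTopology (o : Ordinal.{u}) : OrderTopology (OrdinalSpace o) :=
  inferInstance

/-- The homeomorphism group of the ordinal `o`; the product is composition. -/
abbrev OrdinalHomeo (o : Ordinal.{u}) : Type (u + 1) := OrdinalSpace o ≃ₜ OrdinalSpace o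

/-- Strong distortion: there are `m` and `w₁, w₂, …` such that every sequence `g₁, g₂, …` in `G`
satisfies `gₙ ∈ S ^ wₙ` for all `n`, for some `S ⊆ G` with at most `m` elements. Here `S ^ k` is the
pointwise power, the set of all products `s₁ ⋯ sₖ` of `k` elements of `S`. -/
def IsStronglyDistorted (G : Type v) [Group G] : Prop :=
  ∃ (m : ℕ) (w : ℕ+ → ℕ), ∀ g : ℕ+ → G,
    ∃ S : Finset G, S.card ≤ m ∧ ∀ n, g n ∈ (S : Set G) ^ w n

/-- `g` is (represented by) a word of length at most `k` in the elements of `S` and their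
inverses. -/
def IsWordOfLengthAtMost {G : Type v} [Group G] (S : Set G) (k : ℕ) (g : G) : Prop :=
  ∃ l : List G, l.length ≤ k ∧ (∀ x ∈ l, x ∈ S ∨ x⁻¹ ∈ S) ∧ l.prod = g

/-! ### Clopen subsets of `ω ^ (α + 1)` -/

/-! Let `X = ω ^ (α + 1)`. A clopen set containing infinitely many of the points `ω ^ α * (n + 1)`
is a copy of `X`. Hence `X ≃ₜ ℕ × X`, and of two complementary clopen sets one is a copy of `X`. The
rest of the argument uses only these two facts.

Fragmentation (`exists_factorization`): fix a clopen copy `C` whose complement is a copy, and `s`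
moving that complement into `C`. Every `h` is then a product of three homeomorphisms supported on
`C`, the middle one conjugated by `s`, up to a final `s⁻¹`.

Compression (`eq_commutator_of_cellwise`): cut `X` into cells indexed by two layers of `ℤ × ℤ`, with
`C` the base cell. One homeomorphism `φ` stores all the factors of all the `h n`, each repeated
along a half-row. Bring the half-row of `f` to the base row and take the commutator with the shift
of that row: the repetitions telescope and only `f` on `C` survives. Reaching a row costs linearly
many row shifts, and the layers are linked by `t`, with `s = t ^ 2`. So `φ`, two shifts and `t`
suffice, and only `φ` depends on the sequence. -/

theorem IsClosed.orderTopology_of_wellFoundedLT {X : Type*} [LinearOrder X] [WellFoundedLT X]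
    [TopologicalSpace X] [OrderTopology X] {A : Set X} (hA : IsClosed A) : OrderTopology A := by
  refine ⟨le_antisymm (induced_topology_le_preorder Iff.rfl) ?_⟩
  let _ := Preorder.topology A
  have : OrderTopology A := ⟨rfl⟩
  refine le_of_nhds_le_nhds fun a => ?_
  rw [nhds_induced, nhds_eq_order (a : X), nhds_eq_order a]
  simp only [Filter.comap_inf, Filter.comap_iInf, Filter.comap_principal]
  refine inf_le_inf (le_iInf₂ fun b hb => ?_) (le_iInf₂ fun b hb => ?_)
  -- A lower bound `b` outside `A` is replaced by the supremum of `A ∩ Iic b`, which lies in `A` by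
  -- closedness; in the other case, an upper bound is replaced by the least element of `A` above it.
  · by_cases! h : ∃ x : A, (x : X) ≤ b
    · obtain ⟨x, hx⟩ := h
      have hne : (upperBounds (A ∩ Set.Iic b)).Nonempty := ⟨b, fun y hy => hy.2⟩
      let s := wellFounded_lt.min (upperBounds (A ∩ Set.Iic b)) hne
      have hs : IsLUB (A ∩ Set.Iic b) s :=
        ⟨wellFounded_lt.min_mem _ hne, fun y hy => not_lt.1 (wellFounded_lt.not_lt_min _ hy)⟩
      have hmem : s ∈ A ∩ Set.Iic b := by
        have := hs.mem_closure ⟨x, x.2, hx⟩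
        rwa [(hA.inter isClosed_Iic).closure_eq] at this
      refine iInf₂_le_of_le ⟨s, hmem.1⟩ (lt_of_le_of_lt hmem.2 hb) ?_
      refine Filter.principal_mono.2 fun z hz => ?_
      by_contra hzb
      exact absurd (hs.1 ⟨z.2, not_lt.1 hzb⟩) (not_le.2 hz)
    · exact Filter.le_principal_iff.2 (Filter.univ_mem' h)
  · by_cases! h : ∃ x : A, b ≤ (x : X)
    · let s := wellFounded_lt.min {x : A | b ≤ (x : X)} h
      have hs : b ≤ (s : X) := wellFounded_lt.min_mem _ h
      refine iInf₂_le_of_le s (lt_of_lt_of_le hb hs) (Filter.principal_mono.2 fun z hz => ?_)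
      by_contra hzb
      exact wellFounded_lt.not_lt_min {x : A | b ≤ (x : X)} (not_lt.1 hzb) hz
    · exact Filter.le_principal_iff.2 (Filter.univ_mem' h)

/-- A closed subset of a well-ordered space which contains a copy of the order is homeomorphic to
the whole space. -/
theorem IsClosed.nonempty_homeomorph_of_strictMono {X : Type*} [LinearOrder X] [WellFoundedLT X]
    [TopologicalSpace X] [OrderTopology X] {A : Set X} (hA : IsClosed A) {f : X → X}
    (hf : StrictMono f) (hfA : ∀ x, f x ∈ A) : Nonempty (A ≃ₜ X) := by
  have h₁ : Ordinal.type ((· < ·) : A → A → Prop) ≤ Ordinal.type ((· < ·) : X → X → Prop) :=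
    Ordinal.type_le_iff'.2 ⟨(OrderEmbedding.subtype (· ∈ A)).ltEmbedding⟩
  have h₂ : Ordinal.type ((· < ·) : X → X → Prop) ≤ Ordinal.type ((· < ·) : A → A → Prop) :=
    Ordinal.type_le_iff'.2 ⟨(OrderEmbedding.ofStrictMono (fun x => (⟨f x, hfA x⟩ : A))
      fun _ _ h => hf h).ltEmbedding⟩
  obtain ⟨e⟩ := Ordinal.type_eq.1 (le_antisymm h₁ h₂)
  have := hA.orderTopology_of_wellFoundedLT
  exact ⟨(OrderIso.ofRelIsoLT e).toHomeomorph⟩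

theorem omega0_opow_mul_natCast_lt (α : Ordinal.{u}) (n : ℕ) :
    ω ^ α * (n : Ordinal.{u}) < ω ^ (α + 1) := by
  rw [opow_add_one]
  exact mul_lt_mul_of_pos_left (natCast_lt_omega0 n) (opow_pos _ omega0_pos)

/-- The points of maximal Cantor-Bendixson rank of `ω ^ (α + 1)`. -/
noncomputable def topPoint (α : Ordinal.{u}) (n : ℕ) : OrdinalSpace (ω ^ (α + 1)) :=
  ⟨ω ^ α * ((n + 1 : ℕ) : Ordinal.{u}), omega0_opow_mul_natCast_lt α (n + 1)⟩

theorem topPoint_val (α : Ordinal.{u}) (n : ℕ) :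
    (topPoint α n : Ordinal.{u}) = ω ^ α * (n : Ordinal.{u}) + ω ^ α := by
  simp [topPoint, mul_add]

theorem exists_tail_of_topPoint_mem {α : Ordinal.{u}} {A : Set (OrdinalSpace (ω ^ (α + 1)))}
    (hA : IsOpen A) {n : ℕ} (hn : topPoint α n ∈ A) :
    ∃ γ < ω ^ α, ∀ x : OrdinalSpace (ω ^ (α + 1)),
      ω ^ α * (n : Ordinal.{u}) + γ < x → x ≤ topPoint α n → x ∈ A := by
  have hpos : (0 : Ordinal.{u}) < ω ^ α := opow_pos _ omega0_pos
  have h0 : (⟨0, opow_pos _ omega0_pos⟩ : OrdinalSpace (ω ^ (α + 1))) < topPoint α n := by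
    rw [← Subtype.coe_lt_coe, topPoint_val]
    exact hpos.trans_le le_add_self
  obtain ⟨l, hl, hlA⟩ := exists_Ioc_subset_of_mem_nhds (hA.mem_nhds hn) ⟨_, h0⟩
  refine ⟨(l : Ordinal.{u}) - ω ^ α * (n : Ordinal.{u}), ?_, fun x hx hxn => hlA ⟨?_, hxn⟩⟩
  · have hl' : (l : Ordinal.{u}) < ω ^ α * (n : Ordinal.{u}) + ω ^ α := topPoint_val α n ▸ hl
    by_cases h : ω ^ α * (n : Ordinal.{u}) ≤ l
    · exact (Ordinal.sub_lt_of_le h).2 hl'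
    · rwa [Ordinal.sub_eq_zero_iff_le.2 (not_le.1 h).le]
  · exact (Ordinal.le_add_sub _ _).trans_lt hx

/-- Every tail of a block of length `ω ^ α` still has order type `ω ^ α`, so the `q`-th block fits
into the part of `A` just below the `q`-th top point lying in `A`. -/
theorem exists_strictMono_of_infinite_topPoint {α : Ordinal.{u}}
    {A : Set (OrdinalSpace (ω ^ (α + 1)))} (hA : IsOpen A)
    (hinf : {n | topPoint α n ∈ A}.Infinite) :
    ∃ f : OrdinalSpace (ω ^ (α + 1)) → OrdinalSpace (ω ^ (α + 1)),
      StrictMono f ∧ ∀ x, f x ∈ A := by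
  classical
  have hpos : (0 : Ordinal.{u}) < ω ^ α := opow_pos _ omega0_pos
  have : Infinite {n | topPoint α n ∈ A} := hinf.to_subtype
  let k := Nat.orderEmbeddingOfSet {n | topPoint α n ∈ A}
  have hk : ∀ i, topPoint α (k i) ∈ A := fun i => by
    have : k i ∈ Set.range k := Set.mem_range_self i
    rwa [Nat.orderEmbeddingOfSet_range] at this
  choose γ hγ hγA using fun i => exists_tail_of_topPoint_mem hA (hk i)
  have hq : ∀ x : OrdinalSpace (ω ^ (α + 1)), ∃ q : ℕ, (x : Ordinal.{u}) / ω ^ α = q := fun x =>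
    lt_omega0.1 ((lt_mul_iff_div_lt hpos.ne').1 (opow_add_one ω α ▸ x.2))
  choose q hq using hq
  -- The `+ 1` puts the value strictly beyond `γ`; since `γ` is absorbed by `ω ^ α`, the value does
  -- not pass the top point.
  let F : OrdinalSpace (ω ^ (α + 1)) → Ordinal.{u} := fun x =>
    ω ^ α * (k (q x) : Ordinal.{u}) + (γ (q x) + ((x : Ordinal.{u}) % ω ^ α + 1))
  have hlow : ∀ x, ω ^ α * (k (q x) : Ordinal.{u}) + γ (q x) < F x := fun x => by
    simp only [F]
    rw [← add_assoc]
    exact lt_add_of_pos_right _ (by simp)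
  have hup : ∀ x, F x ≤ topPoint α (k (q x)) := fun x => by
    rw [topPoint_val]
    refine add_le_add_right ?_ _
    calc γ (q x) + ((x : Ordinal.{u}) % ω ^ α + 1) ≤ γ (q x) + ω ^ α :=
          add_le_add_right (Order.add_one_le_of_lt (mod_lt _ hpos.ne')) _
      _ = ω ^ α := add_omega0_opow (hγ _)
  refine ⟨fun x => ⟨F x, (hup x).trans_lt (topPoint α _).2⟩, fun x y hxy => ?_,
    fun x => hγA _ _ (hlow x) (hup x)⟩
  change F x < F y
  have hxy' : (x : Ordinal.{u}) < y := hxy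
  have hle : q x ≤ q y := by
    have : (x : Ordinal.{u}) / ω ^ α ≤ y / ω ^ α :=
      (mul_le_iff_le_div hpos.ne').1 ((mul_div_le _ _).trans hxy'.le)
    rwa [hq, hq, Nat.cast_le] at this
  obtain heq | hlt := hle.eq_or_lt
  · simp only [F, heq]
    rw [← div_add_mod (x : Ordinal.{u}) (ω ^ α), ← div_add_mod (y : Ordinal.{u}) (ω ^ α), hq, hq,
      heq, add_lt_add_iff_left] at hxy'
    rw [add_lt_add_iff_left, add_lt_add_iff_left]
    simpa using hxy'
  · calc F x ≤ topPoint α (k (q x)) := hup x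
      _ ≤ ω ^ α * (k (q y) : Ordinal.{u}) := by
        refine mul_le_mul_right (Nat.cast_le.2 ?_) _
        exact Nat.succ_le_of_lt (k.strictMono hlt)
      _ < F y := lt_of_le_of_lt le_self_add (hlow y)

theorem IsClopen.nonempty_homeomorph_of_infinite_topPoint {α : Ordinal.{u}}
    {A : Set (OrdinalSpace (ω ^ (α + 1)))} (hA : IsClopen A)
    (hinf : {n | topPoint α n ∈ A}.Infinite) : Nonempty (A ≃ₜ OrdinalSpace (ω ^ (α + 1))) :=
  let ⟨_, hf, hfA⟩ := exists_strictMono_of_infinite_topPoint hA.isOpen hinf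
  hA.isClosed.nonempty_homeomorph_of_strictMono hf hfA

theorem IsClopen.nonempty_homeomorph_or_compl {α : Ordinal.{u}}
    {A : Set (OrdinalSpace (ω ^ (α + 1)))} (hA : IsClopen A) :
    Nonempty (A ≃ₜ OrdinalSpace (ω ^ (α + 1))) ∨
      Nonempty ((Aᶜ : Set _) ≃ₜ OrdinalSpace (ω ^ (α + 1))) := by
  by_cases h : {n | topPoint α n ∈ A}.Infinite
  · exact .inl (hA.nonempty_homeomorph_of_infinite_topPoint h)
  · exact .inr (hA.compl.nonempty_homeomorph_of_infinite_topPoint (Set.not_infinite.1 h).infinite_compl)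

theorem isClopen_Iic_of_wellFoundedLT {X : Type*} [LinearOrder X] [WellFoundedLT X]
    [TopologicalSpace X] [OrderTopology X] (a : X) : IsClopen (Set.Iic a) := by
  refine ⟨isClosed_Iic, ?_⟩
  by_cases! h : ∃ b, a < b
  · let s := wellFounded_lt.min {b | a < b} h
    have hs : a < s := wellFounded_lt.min_mem {b | a < b} h
    convert isOpen_Iio (a := s) using 1
    ext x
    refine ⟨fun hx => lt_of_le_of_lt hx hs, fun hx => ?_⟩
    by_contra hxa
    exact wellFounded_lt.not_lt_min {b | a < b} (not_le.1 hxa) hx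
  · convert isOpen_univ using 1
    ext x
    simp [h x]

/-- Locally constant numbering of the blocks of `ω ^ (α + 1)`, one for every top point. -/
theorem exists_continuous_label_topPoint (α : Ordinal.{u}) :
    ∃ l : OrdinalSpace (ω ^ (α + 1)) → ℕ, Continuous l ∧ ∀ n, l (topPoint α n) = n := by
  classical
  have hmono : StrictMono (topPoint α) := fun m n h => by
    rw [← Subtype.coe_lt_coe]
    exact mul_lt_mul_of_pos_left (Nat.cast_lt.2 (Nat.succ_lt_succ h)) (opow_pos _ omega0_pos)
  have hex : ∀ x : OrdinalSpace (ω ^ (α + 1)), ∃ n, x ≤ topPoint α n := fun x => by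
    have hpos : (0 : Ordinal.{u}) < ω ^ α := opow_pos _ omega0_pos
    obtain ⟨n, hn⟩ := lt_omega0.1 ((lt_mul_iff_div_lt hpos.ne').1
      (lt_of_lt_of_eq x.2 (opow_add_one ω α)))
    refine ⟨n, ?_⟩
    rw [← Subtype.coe_le_coe, topPoint_val, ← hn]
    exact (lt_mul_div_add _ hpos.ne').le
  refine ⟨fun x => Nat.find (hex x), continuous_discrete_rng.2 fun n => ?_, fun n => ?_⟩
  · have : (fun x => Nat.find (hex x)) ⁻¹' {n} =
        Set.Iic (topPoint α n) ∩ ⋂ m ∈ Finset.range n, (Set.Iic (topPoint α m))ᶜ := by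
      ext x
      simp [Nat.find_eq_iff]
    rw [this]
    exact (isClopen_Iic_of_wellFoundedLT _).isOpen.inter
      (isOpen_biInter_finset fun m _ => (isClopen_Iic_of_wellFoundedLT _).compl.isOpen)
  · rw [Nat.find_eq_iff]
    exact ⟨le_rfl, fun m hm => not_le.2 (hmono hm)⟩

/-- A space partitioned into countably many open pieces homeomorphic to itself. -/
theorem nonempty_homeomorph_nat_prod {X : Type*} [TopologicalSpace X] (c : X → ℕ)
    (hc : Continuous c) (h : ∀ n, Nonempty ((c ⁻¹' {n} : Set X) ≃ₜ X)) :
    Nonempty (X ≃ₜ ℕ × X) := by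
  let e := fun n => (h n).some
  have hcast : ∀ (n : ℕ) (x : X) (hx : c x = n), e (c x) ⟨x, rfl⟩ = e n ⟨x, hx⟩ := by
    rintro _ x rfl; rfl
  refine ⟨⟨⟨fun x => (c x, e (c x) ⟨x, rfl⟩), fun p => (e p.1).symm p.2, fun x => ?_,
    fun p => ?_⟩, ?_, ?_⟩⟩
  · simp
  · have hp : c ((e p.1).symm p.2) = p.1 := ((e p.1).symm p.2).2
    refine Prod.ext hp ?_
    exact (hcast p.1 _ hp).trans ((e p.1).apply_symm_apply _)
  · refine hc.prodMk (continuous_iff_continuousAt.2 fun x => ?_)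
    have hopen : IsOpen (c ⁻¹' {c x}) := (isOpen_discrete _).preimage hc
    refine ContinuousOn.continuousAt (s := c ⁻¹' {c x}) ?_ (hopen.mem_nhds rfl)
    rw [continuousOn_iff_continuous_domRestrict]
    convert (e (c x)).continuous using 1
    funext y
    exact hcast _ _ y.2
  · exact continuous_prod_of_discrete_left.2 fun n =>
      continuous_subtype_val.comp (e n).symm.continuous

theorem nonempty_homeomorph_nat_prod_ordinalSpace (α : Ordinal.{u}) :
    Nonempty (OrdinalSpace (ω ^ (α + 1)) ≃ₜ ℕ × OrdinalSpace (ω ^ (α + 1))) := by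
  obtain ⟨l, hl, hlt⟩ := exists_continuous_label_topPoint α
  -- Unpairing the block number gives infinitely many classes, each with infinitely many top points.
  have hc : Continuous fun x => (Nat.unpair (l x)).1 :=
    (continuous_of_discreteTopology (f := fun n : ℕ => n.unpair.1)).comp hl
  refine nonempty_homeomorph_nat_prod _ hc fun n => ?_
  refine IsClopen.nonempty_homeomorph_of_infinite_topPoint ((isClopen_discrete _).preimage hc) ?_
  refine Set.infinite_of_injective_forall_mem (f := fun m => Nat.pair n m) (fun a b h => ?_)
    fun m => ?_
  · exact (Nat.pair_eq_pair.1 h).2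
  · simp [hlt]

/-! ### Clopen copies of a space inside itself -/

section Patch

variable {X : Type*}

/-- The map given by `p` on `A`, by `q` on `C \ A`, and fixing every other point. -/
noncomputable def patch (A C : Set X) (p : A → X) (q : (C \ A : Set X) → X) (x : X) : X :=
  open scoped Classical in
  if hA : x ∈ A then p ⟨x, hA⟩ else if hC : x ∈ C then q ⟨x, hC, hA⟩ else x

theorem patch_of_mem {A C : Set X} {p : A → X} {q : (C \ A : Set X) → X} {x : X} (hx : x ∈ A) :
    patch A C p q x = p ⟨x, hx⟩ := dif_pos hx

theorem patch_of_mem_diff {A C : Set X} {p : A → X} {q : (C \ A : Set X) → X} {x : X}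
    (hx : x ∈ C \ A) : patch A C p q x = q ⟨x, hx⟩ := by
  rw [patch, dif_neg hx.2, dif_pos hx.1]

theorem patch_of_notMem {A C : Set X} {p : A → X} {q : (C \ A : Set X) → X} {x : X}
    (hA : x ∉ A) (hC : x ∉ C) : patch A C p q x = x := by
  rw [patch, dif_neg hA, dif_neg hC]

end Patch

section Copies

variable {X : Type*} [TopologicalSpace X]

/-- `A` is a clopen subset homeomorphic to the whole space. -/
def IsClopenCopy (A : Set X) : Prop := IsClopen A ∧ Nonempty (A ≃ₜ X)

theorem IsClopenCopy.image {A : Set X} (hA : IsClopenCopy A) (h : X ≃ₜ X) :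
    IsClopenCopy (h '' A) :=
  ⟨⟨h.isClosed_image.2 hA.1.1, h.isOpen_image.2 hA.1.2⟩, hA.2.map fun e => (h.image A).symm.trans e⟩

/-- A clopen set and its complement decompose the space as a sum. -/
def IsClopen.sumComplHomeomorph {A : Set X} [DecidablePred (· ∈ A)] (hA : IsClopen A) :
    A ⊕ (Aᶜ : Set X) ≃ₜ X :=
  (Equiv.Set.sumCompl A).toHomeomorphOfContinuousOpen
    (continuous_sum_dom.2 ⟨continuous_subtype_val, continuous_subtype_val⟩)
    (isOpenMap_sum.2 ⟨hA.isOpen.isOpenMap_subtype_val, hA.compl.isOpen.isOpenMap_subtype_val⟩)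

/-- Hilbert's hotel: `X` splits off `ℕ × R`, which absorbs one more `R`. -/
theorem nonempty_sum_clopen_homeomorph (e : X ≃ₜ ℕ × X) {R : Set X} (hR : IsClopen R) :
    Nonempty (X ⊕ R ≃ₜ X) := by
  classical
  let d : X ≃ₜ (ℕ × R) ⊕ (ℕ × (Rᶜ : Set X)) :=
    e.trans (((Homeomorph.refl ℕ).prodCongr hR.sumComplHomeomorph.symm).trans
      Homeomorph.prodSumDistrib)
  let a : (ℕ × R) ⊕ R ≃ₜ ℕ × R :=
    ((Homeomorph.refl _).sumCongr (Homeomorph.punitProd.{_, 0} R).symm).trans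
      (Homeomorph.sumProdDistrib.symm.trans
        (Equiv.natSumPUnitEquivNat.toHomeomorphOfDiscrete.prodCongr (Homeomorph.refl R)))
  exact ⟨(d.sumCongr (Homeomorph.refl R)).trans <|
    ((Homeomorph.sumComm _ _).sumCongr (Homeomorph.refl R)).trans <|
    (Homeomorph.sumAssoc _ _ _).trans <|
    ((Homeomorph.refl _).sumCongr a).trans <| (Homeomorph.sumComm _ _).trans d.symm⟩

/-- The remainder `B \ A` is absorbed by the copy `A`. Thus a clopen set is recognised as a copy by
finding a copy inside it. -/
theorem IsClopenCopy.mono (e : X ≃ₜ ℕ × X) {A B : Set X} (hA : IsClopenCopy A) (hB : IsClopen B)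
    (hAB : A ⊆ B) : IsClopenCopy B := by
  classical
  obtain ⟨p⟩ := hA.2
  obtain ⟨q⟩ := nonempty_sum_clopen_homeomorph e (hB.diff hA.1)
  have hA' : IsClopen ((↑) ⁻¹' A : Set B) := hA.1.preimage continuous_subtype_val
  let p' : ((↑) ⁻¹' A : Set B) ≃ₜ A :=
    { toFun := fun x => ⟨x, x.2⟩
      invFun := fun x => ⟨⟨x, hAB x.2⟩, x.2⟩
      left_inv := fun _ => rfl
      right_inv := fun _ => rfl
      continuous_toFun := by fun_prop
      continuous_invFun := by fun_prop }
  let r' : (((↑) ⁻¹' A : Set B)ᶜ : Set B) ≃ₜ (B \ A : Set X) :=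
    { toFun := fun x => ⟨x, x.1.2, x.2⟩
      invFun := fun x => ⟨⟨x, x.2.1⟩, x.2.2⟩
      left_inv := fun _ => rfl
      right_inv := fun _ => rfl
      continuous_toFun := by fun_prop
      continuous_invFun := by fun_prop }
  exact ⟨hB, ⟨hA'.sumComplHomeomorph.symm.trans (((p'.trans p).sumCongr r').trans q)⟩⟩

theorem IsClopenCopy.inter_or_inter_compl
    (hX : ∀ A : Set X, IsClopen A → Nonempty (A ≃ₜ X) ∨ Nonempty ((Aᶜ : Set X) ≃ₜ X))
    {A B : Set X} (hA : IsClopenCopy A) (hB : IsClopen B) :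
    IsClopenCopy (A ∩ B) ∨ IsClopenCopy (A ∩ Bᶜ) := by
  obtain ⟨e⟩ := hA.2
  let r : ∀ D : Set X, (A ∩ D : Set X) ≃ₜ {x : X | (e.symm x : X) ∈ D} := fun D =>
    { toFun := fun x => ⟨e ⟨x, x.2.1⟩, by simpa using x.2.2⟩
      invFun := fun y => ⟨e.symm y, (e.symm y).2, y.2⟩
      left_inv := fun x => by simp
      right_inv := fun y => by simp
      continuous_toFun := by fun_prop
      continuous_invFun := by fun_prop }
  have hc : IsClopen {x : X | (e.symm x : X) ∈ B} :=
    hB.preimage (continuous_subtype_val.comp e.symm.continuous)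
  exact (hX _ hc).imp (fun h => ⟨hA.1.inter hB, h.map fun k => (r B).trans k⟩)
    fun h => ⟨hA.1.inter hB.compl, h.map fun k => (r Bᶜ).trans k⟩

/-- The piece with label `i` of a space homeomorphic to `ι × X`. -/
theorem isClopenCopy_label {ι : Type*} [TopologicalSpace ι] [DiscreteTopology ι]
    (e : X ≃ₜ ι × X) (i : ι) : IsClopenCopy {x | (e x).1 = i} := by
  refine ⟨(isClopen_discrete {i}).preimage (continuous_fst.comp e.continuous), ⟨?_⟩⟩
  exact
    { toFun := fun x => (e x).2
      invFun := fun y => ⟨e.symm (i, y), by simp⟩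
      left_inv := fun x => Subtype.ext <| e.symm_apply_eq.2 <| Prod.ext x.2.symm rfl
      right_inv := fun y => by simp
      continuous_toFun := by fun_prop
      continuous_invFun := by fun_prop }

theorem IsClopenCopy.exists_disjoint (e : X ≃ₜ ℕ × X) {A : Set X} (hA : IsClopenCopy A) :
    ∃ Q Q' : Set X, IsClopenCopy Q ∧ IsClopenCopy Q' ∧ Q ⊆ A ∧ Q' ⊆ A ∧ Disjoint Q Q' := by
  obtain ⟨p⟩ := hA.2
  have hcopy : ∀ S : Set X, IsClopenCopy S →
      IsClopenCopy (Subtype.val '' (p ⁻¹' S)) := fun S hS => by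
    have hS' : IsClopen (p ⁻¹' S) := hS.1.preimage p.continuous
    refine ⟨⟨hA.1.isClosed.isClosedMap_subtype_val _ hS'.1,
      hA.1.isOpen.isOpenMap_subtype_val _ hS'.2⟩, ?_⟩
    obtain ⟨k⟩ := hS.2
    exact ⟨((IsEmbedding.subtypeVal.homeomorphImage _).symm.trans (p.sets rfl)).trans k⟩
  refine ⟨_, _, hcopy _ (isClopenCopy_label e 0), hcopy _ (isClopenCopy_label e 1),
    Subtype.coe_image_subset _ _, Subtype.coe_image_subset _ _, ?_⟩
  rw [Set.disjoint_image_iff Subtype.val_injective]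
  exact Set.disjoint_left.2 fun x (h₀ : (e (p x)).1 = 0) (h₁ : (e (p x)).1 = 1) => by
    simp [h₀] at h₁

theorem continuous_patch {A C : Set X} (hA : IsClopen A) (hC : IsClopen C) {p : A → X}
    {q : (C \ A : Set X) → X} (hp : Continuous p) (hq : Continuous q) :
    Continuous (patch A C p q) := by
  refine continuous_iff_continuousAt.2 fun x => ?_
  by_cases hxA : x ∈ A
  · refine ContinuousOn.continuousAt (s := A) ?_ (hA.isOpen.mem_nhds hxA)
    rw [continuousOn_iff_continuous_domRestrict]
    convert hp using 1
    exact funext fun y => patch_of_mem y.2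
  by_cases hxC : x ∈ C
  · refine ContinuousOn.continuousAt (s := C \ A) ?_ ((hC.diff hA).isOpen.mem_nhds ⟨hxC, hxA⟩)
    rw [continuousOn_iff_continuous_domRestrict]
    convert hq using 1
    exact funext fun y => patch_of_mem_diff y.2
  · refine ContinuousOn.continuousAt (s := Aᶜ ∩ Cᶜ) ?_
      ((hA.compl.inter hC.compl).isOpen.mem_nhds ⟨hxA, hxC⟩)
    exact continuousOn_id.congr fun y hy => patch_of_notMem hy.1 hy.2

theorem patch_symm_patch {A B C : Set X} (p : A ≃ₜ B)
    (q : (C \ A : Set X) ≃ₜ (C \ B : Set X)) (hB : B ⊆ C) (x : X) :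
    patch B C (fun y => (p.symm y : X)) (fun y => (q.symm y : X))
      (patch A C (fun y => (p y : X)) (fun y => (q y : X)) x) = x := by
  by_cases hxA : x ∈ A
  · rw [patch_of_mem hxA, patch_of_mem (p ⟨x, hxA⟩).2]
    simp
  by_cases hxC : x ∈ C
  · rw [patch_of_mem_diff ⟨hxC, hxA⟩, patch_of_mem_diff (q ⟨x, hxC, hxA⟩).2]
    simp
  · rw [patch_of_notMem hxA hxC, patch_of_notMem (fun h => hxC (hB h)) hxC]

/-- A homeomorphism between two subsets of `C` with homeomorphic clopen complements in `C` extends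
to a homeomorphism of the space supported on `C`. -/
theorem exists_homeomorph_extending {A B C : Set X} (hA : IsClopen A) (hB : IsClopen B)
    (hC : IsClopen C) (hAC : A ⊆ C) (hBC : B ⊆ C) (p : A ≃ₜ B)
    (hq : Nonempty ((C \ A : Set X) ≃ₜ (C \ B : Set X))) :
    ∃ g : X ≃ₜ X, (∀ x, x ∉ C → g x = x) ∧ ∀ x : A, g x = p x := by
  obtain ⟨q⟩ := hq
  refine ⟨⟨⟨patch A C (fun y => (p y : X)) (fun y => (q y : X)),
    patch B C (fun y => (p.symm y : X)) (fun y => (q.symm y : X)),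
    patch_symm_patch p q hBC, patch_symm_patch p.symm q.symm hAC⟩,
    continuous_patch hA hC (continuous_subtype_val.comp p.continuous)
      (continuous_subtype_val.comp q.continuous),
    continuous_patch hB hC (continuous_subtype_val.comp p.symm.continuous)
      (continuous_subtype_val.comp q.symm.continuous)⟩, fun x hx => ?_, fun x => ?_⟩
  · exact patch_of_notMem (p := fun y => (p y : X)) (q := fun y => (q y : X))
      (fun h => hx (hAC h)) hx
  · exact patch_of_mem (C := C) (p := fun y => (p y : X)) (q := fun y => (q y : X)) x.2

/-- If `s` moves the complement of `C` into `C`, a homeomorphism that keeps a copy of the space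
inside `C` is a product of three homeomorphisms supported on `C`, `s '' C` and `C`. -/
theorem exists_factorization_of_copy (e : X ≃ₜ ℕ × X) {C : Set X} (hC : IsClopenCopy C)
    (hC' : IsClopenCopy Cᶜ) (s : X ≃ₜ X) (hs : ∀ x, x ∉ C → s x ∈ C)
    (hsC : IsClopenCopy (C ∩ s '' C)) (h : X ≃ₜ X) (hh : IsClopenCopy (C ∩ h ⁻¹' C)) :
    ∃ f₁ f₂ f₃ : X ≃ₜ X, (∀ x, x ∉ C → f₁ x = x) ∧ (∀ x, x ∉ C → f₂ x = x) ∧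
      (∀ x, x ∉ C → f₃ x = x) ∧ h = f₁ * (s * f₂ * s⁻¹) * f₃ := by
  -- `Q'` only serves to make `C \ Q` and `C \ h '' Q` copies, so that the partial maps below
  -- extend.
  obtain ⟨Q, Q', hQ, hQ', hQC, hQC', hdisj⟩ := hh.exists_disjoint e
  have hP : IsClopenCopy (s '' Cᶜ) := hC'.image s
  have hPC : s '' Cᶜ ⊆ C := Set.image_subset_iff.2 hs
  have hP' : IsClopenCopy (C \ s '' Cᶜ) := by
    rwa [Set.image_compl_eq s.bijective, Set.sdiff_compl]
  have hhQC : h '' Q ⊆ C := Set.image_subset_iff.2 fun x hx => (hQC hx).2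
  have hQd : IsClopenCopy (C \ Q) := hQ'.mono e (hC.1.diff hQ.1) fun x hx =>
    ⟨(hQC' hx).1, Set.disjoint_right.1 hdisj hx⟩
  have hhQd : IsClopenCopy (C \ h '' Q) := by
    refine (hQ'.image h).mono e (hC.1.diff (hQ.image h).1) ?_
    rintro _ ⟨x, hx, rfl⟩
    exact ⟨(hQC' hx).2, fun hx' => Set.disjoint_right.1 hdisj hx (h.injective.mem_set_image.1 hx')⟩
  -- `f₃` carries `Q` onto `s '' Cᶜ` and `f₁` carries that onto `h '' Q`, with `f₁ * f₃ = h` on `Q`.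
  -- Hence `f₁⁻¹ * h * f₃⁻¹` fixes `s '' Cᶜ` pointwise, and its conjugate by `s⁻¹` is supported on
  -- `C`.
  let p : Q ≃ₜ s '' Cᶜ := hQ.2.some.trans hP.2.some.symm
  obtain ⟨f₃, hf₃, hf₃p⟩ := exists_homeomorph_extending hQ.1 hP.1 hC.1 (fun x hx => (hQC hx).1) hPC
    p ⟨hQd.2.some.trans hP'.2.some.symm⟩
  obtain ⟨f₁, hf₁, hf₁p⟩ := exists_homeomorph_extending hP.1 (hQ.image h).1 hC.1 hPC hhQC
    (p.symm.trans (h.image Q)) ⟨hP'.2.some.trans hhQd.2.some.symm⟩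
  refine ⟨f₁, s⁻¹ * f₁⁻¹ * h * f₃⁻¹ * s, f₃, hf₁, fun x hx => ?_, hf₃, by group⟩
  have hx' : s x ∈ s '' Cᶜ := Set.mem_image_of_mem s hx
  have h₃ : f₃.symm (s x) = p.symm ⟨s x, hx'⟩ := by
    rw [f₃.symm_apply_eq, hf₃p, p.apply_symm_apply]
  have h₁ : h (p.symm ⟨s x, hx'⟩) = f₁ (s x) := (hf₁p ⟨s x, hx'⟩).symm
  simp [h₃, h₁]

/-- Either `C` or its complement meets `h ⁻¹' C` in a copy. In the second case `h * s` replaces `h`,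
because `s⁻¹` also moves the complement of `C` into `C`. -/
theorem exists_factorization (e : X ≃ₜ ℕ × X)
    (hX : ∀ A : Set X, IsClopen A → Nonempty (A ≃ₜ X) ∨ Nonempty ((Aᶜ : Set X) ≃ₜ X))
    {C : Set X} (hC : IsClopenCopy C) (hC' : IsClopenCopy Cᶜ) (s : X ≃ₜ X)
    (hs : ∀ x, x ∉ C → s x ∈ C) (hsC : IsClopenCopy (C ∩ s '' C)) (h : X ≃ₜ X) :
    ∃ f₁ f₂ f₃ : X ≃ₜ X, (∀ x, x ∉ C → f₁ x = x) ∧ (∀ x, x ∉ C → f₂ x = x) ∧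
      (∀ x, x ∉ C → f₃ x = x) ∧ (h = f₁ * (s * f₂ * s⁻¹) * f₃ ∨
        h = f₁ * (s * f₂ * s⁻¹) * f₃ * s⁻¹) := by
  have hpre : IsClopenCopy (h ⁻¹' C) := h.symm.image_eq_preimage_symm C ▸ hC.image h.symm
  rcases hpre.inter_or_inter_compl hX hC.1 with hcase | hcase
  · obtain ⟨f₁, f₂, f₃, h₁, h₂, h₃, H⟩ := exists_factorization_of_copy e hC hC' s hs hsC h
      (Set.inter_comm C _ ▸ hcase)
    exact ⟨f₁, f₂, f₃, h₁, h₂, h₃, .inl H⟩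
  · have hcopy : IsClopenCopy (C ∩ (h * s) ⁻¹' C) := by
      have hclopen : IsClopen (C ∩ (h * s) ⁻¹' C) := hC.1.inter (hC.1.preimage (h * s).continuous)
      refine (hcase.image s.symm).mono e hclopen ?_
      rintro _ ⟨x, ⟨hxh, hxC⟩, rfl⟩
      refine ⟨?_, by simpa using hxh⟩
      by_contra hn
      exact hxC (by simpa using hs _ hn)
    obtain ⟨f₁, f₂, f₃, h₁, h₂, h₃, H⟩ := exists_factorization_of_copy e hC hC' s hs hsC _ hcopy
    exact ⟨f₁, f₂, f₃, h₁, h₂, h₃, .inr (by rw [← H, mul_inv_cancel_right])⟩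

/-- Homeomorphisms preserving the pieces of a locally constant labelling glue together. -/
def glueHomeomorph {ι : Type*} [TopologicalSpace ι] [DiscreteTopology ι] (c : X → ι)
    (hc : Continuous c) (g : ι → X ≃ₜ X) (hg : ∀ i x, c (g i x) = i ↔ c x = i) : X ≃ₜ X :=
  have key : ∀ k : ι → X ≃ₜ X, Continuous fun x => k (c x) x := fun k =>
    continuous_iff_continuousAt.2 fun x => by
      refine (k (c x)).continuous.continuousAt.congr ?_
      filter_upwards [((isOpen_discrete {c x}).preimage hc).mem_nhds rfl] with y hy
      rw [show c y = c x from hy]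
  { toFun := fun x => g (c x) x
    invFun := fun x => (g (c x)).symm x
    left_inv := fun x => by simp [(hg (c x) x).2 rfl]
    right_inv := fun x => by
      have : c ((g (c x)).symm x) = c x := by rw [← hg]; simp
      simp [this]
    continuous_toFun := key g
    continuous_invFun := key fun i => (g i).symm }

theorem glueHomeomorph_apply {ι : Type*} [TopologicalSpace ι] [DiscreteTopology ι] (c : X → ι)
    (hc : Continuous c) (g : ι → X ≃ₜ X) (hg : ∀ i x, c (g i x) = i ↔ c x = i) (x : X) :
    glueHomeomorph c hc g hg x = g (c x) x := rfl

end Copies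

/-! ### Permutations of a two-layer lattice of cells -/

/-- The cells: two layers of a planar lattice. -/
abbrev Cell : Type := Bool × ℤ × ℤ

/-- The sites: every cell consists of countably many of them. -/
abbrev Site : Type := Cell × ℕ

/-- The cell at the origin of the lower layer. -/
def baseCell : Cell := (false, 0, 0)

/-- The permutation of the sites induced by a permutation of the cells. -/
def cellPerm (π : Equiv.Perm Cell) : Equiv.Perm Site := π.prodCongr (Equiv.refl ℕ)

@[simp]
theorem cellPerm_apply (π : Equiv.Perm Cell) (c : Cell) (k : ℕ) : cellPerm π (c, k) = (π c, k) :=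
  rfl

/-- Shift of all the rows. -/
def rowShift : Equiv.Perm Site :=
  cellPerm ((Equiv.refl Bool).prodCongr ((Equiv.addRight 1).prodCongr (Equiv.refl ℤ)))

/-- Shift along the row of the base cell. -/
def baseRowShift : Equiv.Perm Site :=
  cellPerm
    { toFun := fun c => if c.1 = false ∧ c.2.1 = 0 then (c.1, c.2.1, c.2.2 + 1) else c
      invFun := fun c => if c.1 = false ∧ c.2.1 = 0 then (c.1, c.2.1, c.2.2 - 1) else c
      left_inv := fun c => by
        by_cases h : c.1 = false ∧ c.2.1 = 0
        · simp [h, Prod.ext_iff]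
        · simp [h]
      right_inv := fun c => by
        by_cases h : c.1 = false ∧ c.2.1 = 0
        · simp [h, Prod.ext_iff]
        · simp [h] }

theorem baseRowShift_apply_base (m : ℤ) (k : ℕ) :
    baseRowShift ((false, 0, m), k) = ((false, 0, m + 1), k) := by
  simp [baseRowShift]

theorem baseRowShift_apply_of_ne {w : Site} (h : ∀ m, w.1 ≠ (false, 0, m)) :
    baseRowShift w = w := by
  obtain ⟨⟨b, n, m⟩, k⟩ := w
  have : ¬ (b = false ∧ n = 0) := by
    rintro ⟨rfl, rfl⟩
    exact h m rfl
  simp [baseRowShift, this]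

theorem rowShift_apply (b : Bool) (n m : ℤ) (k : ℕ) :
    rowShift ((b, n, m), k) = ((b, n + 1, m), k) := rfl

theorem rowShift_pow_apply (i : ℕ) (b : Bool) (n m : ℤ) (k : ℕ) :
    (rowShift ^ i) ((b, n, m), k) = ((b, n + i, m), k) := by
  induction i generalizing n with
  | zero => simp
  | succ i ih =>
    rw [pow_succ, Equiv.Perm.mul_apply, rowShift_apply, ih]
    push_cast
    rw [add_assoc, add_comm (1 : ℤ)]

theorem rowShift_pow_inv_apply (i : ℕ) (b : Bool) (n m : ℤ) (k : ℕ) :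
    (rowShift ^ i)⁻¹ ((b, n, m), k) = ((b, n - i, m), k) := by
  rw [Equiv.Perm.inv_eq_iff_eq, rowShift_pow_apply, sub_add_cancel]

/-- Closes the gap at the origin of the lattice. -/
def closeGap (p : ℤ × ℤ) : ℤ × ℤ := if p.1 = 0 ∧ 0 < p.2 then (0, p.2 - 1) else p

/-- Opens a gap at the origin of the lattice. -/
def openGap (p : ℤ × ℤ) : ℤ × ℤ := if p.1 = 0 ∧ 0 ≤ p.2 then (0, p.2 + 1) else p

theorem closeGap_openGap (p : ℤ × ℤ) : closeGap (openGap p) = p := by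
  obtain ⟨a, b⟩ := p
  simp only [closeGap, openGap]
  grind

theorem openGap_closeGap {p : ℤ × ℤ} (hp : p ≠ (0, 0)) : openGap (closeGap p) = p := by
  obtain ⟨a, b⟩ := p
  simp only [closeGap, openGap]
  grind

theorem openGap_ne (p : ℤ × ℤ) : openGap p ≠ (0, 0) := by
  obtain ⟨a, b⟩ := p
  simp only [openGap]
  grind

/-- A permutation mapping the row after the base row to the upper layer, whose square maps the
complement of the base cell into the base cell, and which fixes a site of the base cell. It
permutes cyclically the rest of the lower layer, the upper layer, and two parts of the base cell. -/
theorem exists_perm_square_into_baseCell :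
    ∃ t : Equiv.Perm Site, (∀ m k, t ((false, 1, m), k) = ((true, 1, m), k)) ∧
      (∀ w : Site, w.1 ≠ baseCell → (t (t w)).1 = baseCell) ∧
      ∃ k, t (baseCell, k) = (baseCell, k) := by
  -- The base cell is split into two parts, each as large as a layer, and one site to be fixed. The
  -- cycle is: lower layer without base cell, upper layer, first part, second part.
  obtain ⟨θ⟩ : Nonempty (ℕ ≃ (((ℤ × ℤ) × ℕ) ⊕ ((ℤ × ℤ) × ℕ)) ⊕ Unit) :=
    nonempty_equiv_of_countable
  let f : Site → Site := fun w =>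
    if w.1.1 = true then (baseCell, θ.symm (.inl (.inl (w.1.2, w.2))))
    else if w.1.2 = (0, 0) then
      match θ w.2 with
      | .inl (.inl b) => (baseCell, θ.symm (.inl (.inr b)))
      | .inl (.inr b) => ((false, openGap b.1), b.2)
      | .inr _ => w
    else ((true, closeGap w.1.2), w.2)
  let g : Site → Site := fun w =>
    if w.1.1 = true then ((false, openGap w.1.2), w.2)
    else if w.1.2 = (0, 0) then
      match θ w.2 with
      | .inl (.inl b) => ((true, b.1), b.2)
      | .inl (.inr b) => (baseCell, θ.symm (.inl (.inl b)))
      | .inr _ => w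
    else (baseCell, θ.symm (.inl (.inr (closeGap w.1.2, w.2))))
  have hup : ∀ p k, f ((true, p), k) = (baseCell, θ.symm (.inl (.inl (p, k)))) := fun p k => rfl
  have hlow : ∀ p k, p ≠ (0, 0) → f ((false, p), k) = ((true, closeGap p), k) := fun p k hp => by
    simp [f, hp]
  have hgf : ∀ w, g (f w) = w := by
    rintro ⟨⟨_ | _, p⟩, k⟩
    · by_cases hp : p = (0, 0)
      · subst hp
        obtain ⟨x, rfl⟩ := θ.symm.surjective k
        rcases x with (b | b) | b
        · simp [f, g, baseCell]
        · simp [f, g, baseCell, openGap_ne, closeGap_openGap]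
        · simp [f, g]
      · simp [hlow p k hp, g, openGap_closeGap hp]
    · simp [hup, g, baseCell]
  have hfg : ∀ w, f (g w) = w := by
    rintro ⟨⟨_ | _, p⟩, k⟩
    · by_cases hp : p = (0, 0)
      · subst hp
        obtain ⟨x, rfl⟩ := θ.symm.surjective k
        rcases x with (b | b) | b
        · simp [f, g, baseCell]
        · simp [f, g, baseCell]
        · simp [f, g]
      · simp [f, g, hp, baseCell, openGap_closeGap hp]
    · simp [f, g, openGap_ne, closeGap_openGap]
  refine ⟨⟨f, g, hgf, hfg⟩, fun m k => ?_, ?_, θ.symm (.inr ()), ?_⟩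
  · change f ((false, 1, m), k) = _
    -- Closing the gap moves only points of row `0`, so row `1` rises unchanged.
    rw [hlow _ _ (by simp)]
    simp [closeGap]
  · rintro ⟨⟨_ | _, p⟩, k⟩ hw
    · have hp : p ≠ (0, 0) := fun h => hw (by rw [h, baseCell])
      change (f (f _)).1 = _
      rw [hlow _ _ hp, hup]
    · change (f (f _)).1 = _
      simp [f, baseCell]
  · change f (baseCell, θ.symm (.inr ())) = _
    simp [f, baseCell]

/-! ### Permutations of the sites acting on a space -/

section Action

variable {X : Type*} [TopologicalSpace X] (e : X ≃ₜ Site × X)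

/-- The action on `X ≃ₜ Site × X` of the permutations of the sites. -/
def siteHom : Equiv.Perm Site →* (X ≃ₜ X) where
  toFun π := (e.trans (π.toHomeomorphOfDiscrete.prodCongr (Homeomorph.refl X))).trans e.symm
  map_one' := Homeomorph.ext fun x => e.symm_apply_apply x
  map_mul' π ρ := Homeomorph.ext fun x => by simp; rfl

theorem apply_siteHom (π : Equiv.Perm Site) (x : X) :
    e (siteHom e π x) = (π (e x).1, (e x).2) := e.apply_symm_apply _

theorem siteHom_congr {π ρ : Equiv.Perm Site} {x : X} (h : π (e x).1 = ρ (e x).1) :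
    siteHom e π x = siteHom e ρ x :=
  e.injective (by rw [apply_siteHom, apply_siteHom, h])

theorem siteHom_eq_self {π : Equiv.Perm Site} {x : X} (h : π (e x).1 = (e x).1) :
    siteHom e π x = x := by
  have := siteHom_congr e (π := π) (ρ := 1) h
  rwa [map_one] at this

theorem siteHom_injective [Nonempty X] : Function.Injective (siteHom e) := fun π ρ h => by
  obtain ⟨y⟩ := ‹Nonempty X›
  ext1 w
  have := congrArg (fun k : X ≃ₜ X => (e (k (e.symm (w, y)))).1) h
  simpa [apply_siteHom] using this

/-- The points lying over the base cell. -/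
def baseSet : Set X := {x | (e x).1.1 = baseCell}

theorem isClopen_baseSet : IsClopen (baseSet e) :=
  (isClopen_discrete {w : Site | w.1 = baseCell}).preimage (continuous_fst.comp e.continuous)

/-- Exchange of the base cell with another cell. -/
def exchange (c : Cell) : Equiv.Perm Site := cellPerm (Equiv.swap baseCell c)

theorem exchange_apply_base {c : Cell} {w : Site} (h : w.1 = baseCell) :
    exchange c w = (c, w.2) := by
  obtain ⟨c', k⟩ := w
  obtain rfl : c' = baseCell := h
  simp [exchange]

theorem exchange_exchange (c : Cell) (w : Site) : exchange c (exchange c w) = w := by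
  obtain ⟨c', k⟩ := w
  simp [exchange]

theorem exists_exchange_of_cell_eq {c : Cell} {x : X} (h : (e x).1.1 = c) :
    ∃ y ∈ baseSet e, siteHom e (exchange c) y = x := by
  refine ⟨siteHom e (exchange c) x, ?_, e.injective ?_⟩
  · simp [baseSet, apply_siteHom, exchange, cellPerm, h]
  · simp [apply_siteHom, exchange_exchange]

variable {e}

theorem mem_baseSet_of_fixes {f : X ≃ₜ X} (hf : ∀ x, x ∉ baseSet e → f x = x) {x : X} :
    f x ∈ baseSet e ↔ x ∈ baseSet e := by
  refine ⟨fun h => ?_, fun h => ?_⟩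
  · by_contra hx
    exact hx (hf x hx ▸ h)
  · by_contra hx
    exact hx ((f.injective (hf _ hx)).symm ▸ h)

variable (e)

/-- For a family of homeomorphisms supported on the base cell there is a homeomorphism acting on
every cell as the corresponding member of the family. -/
theorem exists_cellwise (F : Cell → X ≃ₜ X) (hF : ∀ c x, x ∉ baseSet e → F c x = x) :
    ∃ φ : X ≃ₜ X, ∀ c, ∀ x ∈ baseSet e,
      φ (siteHom e (exchange c) x) = siteHom e (exchange c) (F c x) := by
  have hcell : Continuous fun x => (e x).1.1 := by fun_prop
  have hbase : ∀ c x, (e (siteHom e (exchange c) x)).1.1 = c ↔ x ∈ baseSet e := fun c x => by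
    simp [apply_siteHom, baseSet, exchange, cellPerm, Equiv.swap_apply_eq_iff]
  refine ⟨glueHomeomorph _ hcell
    (fun c => siteHom e (exchange c) * F c * siteHom e (exchange c)) fun c x => ?_,
    fun c x hx => ?_⟩
  · simp only [Homeomorph.mul_apply]
    rw [hbase, mem_baseSet_of_fixes (hF c), baseSet, Set.mem_ofPred_eq, apply_siteHom]
    simp [exchange, cellPerm, Equiv.swap_apply_eq_iff]
  · rw [glueHomeomorph_apply, (hbase c x).2 hx]
    simp only [Homeomorph.mul_apply]
    congr 2
    refine e.injective ?_
    simp [apply_siteHom, exchange_exchange]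

/-- A homeomorphism supported on the base cell is recovered as a commutator. -/
theorem eq_commutator_of_cellwise {F : Cell → X ≃ₜ X} (hF : ∀ c x, x ∉ baseSet e → F c x = x)
    {φ : X ≃ₜ X} (hφ : ∀ c, ∀ x ∈ baseSet e,
      φ (siteHom e (exchange c) x) = siteHom e (exchange c) (F c x))
    {f : X ≃ₜ X} (hf : ∀ x, x ∉ baseSet e → f x = x) {u : Equiv.Perm Site} {c : ℤ → Cell}
    (hu : ∀ m k, u ((false, 0, m), k) = (c m, k)) (hpos : ∀ m, 0 ≤ m → F (c m) = f)
    (hneg : ∀ m, m < 0 → F (c m) = 1) :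
    f = ((siteHom e u)⁻¹ * φ * siteHom e u) * siteHom e baseRowShift *
      ((siteHom e u)⁻¹ * φ * siteHom e u)⁻¹ * (siteHom e baseRowShift)⁻¹ := by
  set ψ := (siteHom e u)⁻¹ * φ * siteHom e u with hψ
  set τ := siteHom e baseRowShift with hτ
  -- Along the base row `ψ` acts as `f` on cells `m ≥ 0` and trivially on `m < 0`. Both sides thus
  -- agree away from the step from cell `-1` to cell `0`, where the extra `f` on the left supplies
  -- the difference. Off the row `τ` and `f` are trivial and `ψ` preserves the complement.
  suffices H : f * τ * ψ = ψ * τ by rw [← H]; group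
  let T : ℤ → X ≃ₜ X := fun m => siteHom e (exchange (false, 0, m))
  have hT : ∀ m, ∀ x ∈ baseSet e, (e (T m x)).1 = ((false, 0, m), (e x).1.2) := fun m x hx => by
    simp only [T, apply_siteHom]
    exact exchange_apply_base hx
  have hψT : ∀ m, ∀ x ∈ baseSet e, ψ (T m x) = T m (F (c m) x) := fun m x hx => by
    have huT : ∀ y ∈ baseSet e, siteHom e u (T m y) = siteHom e (exchange (c m)) y :=
      fun y hy => e.injective <| by
        refine Prod.ext ?_ (by simp [T, apply_siteHom])
        rw [apply_siteHom e u, hT m y hy, hu, apply_siteHom e (exchange (c m)), exchange_apply_base hy]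
    have hFx := (mem_baseSet_of_fixes (hF (c m))).2 hx
    simp only [hψ, Homeomorph.mul_apply]
    rw [huT x hx, hφ _ x hx, ← huT _ hFx, Homeomorph.inv_apply, Homeomorph.symm_apply_apply]
  have hτT : ∀ m, ∀ x ∈ baseSet e, τ (T m x) = T (m + 1) x := fun m x hx => e.injective <| by
    refine Prod.ext ?_ ?_
    · rw [hT _ x hx, hτ, apply_siteHom, hT m x hx, baseRowShift_apply_base]
    · simp [T, hτ, apply_siteHom]
  have hτfix : ∀ x, (∀ m, (e x).1.1 ≠ (false, 0, m)) → τ x = x := fun x hx =>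
    siteHom_eq_self e (baseRowShift_apply_of_ne hx)
  ext1 x
  simp only [Homeomorph.mul_apply]
  by_cases hx : ∃ m, (e x).1.1 = (false, 0, m)
  · obtain ⟨m, hm⟩ := hx
    obtain ⟨y, hy, rfl⟩ := exists_exchange_of_cell_eq e hm
    change f (τ (ψ (T m y))) = ψ (τ (T m y))
    have hFy := (mem_baseSet_of_fixes (hF (c m))).2 hy
    rw [hψT m y hy, hτT m _ hFy, hτT m y hy, hψT _ y hy]
    obtain hm0 | hm0 := eq_or_ne (m + 1) 0
    · have hT0 : ∀ z ∈ baseSet e, T 0 z = z := fun z hz =>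
        siteHom_eq_self e (exchange_apply_base hz |>.trans (Prod.ext hz.symm rfl))
      rw [hm0, hneg m (by omega), hpos 0 le_rfl, Homeomorph.one_apply, hT0 y hy,
        hT0 _ ((mem_baseSet_of_fixes hf).2 hy)]
    · rw [hf]
      · obtain h | h := lt_or_ge m 0
        · rw [hneg m h, hneg (m + 1) (by omega)]
        · rw [hpos m h, hpos (m + 1) (by omega)]
      · intro hmem
        have : ((e (T (m + 1) (F (c m) y))).1.1) = baseCell := hmem
        rw [hT _ _ hFy, baseCell] at this
        simp [hm0] at this
  · push Not at hx
    have hψx : ∀ m, (e (ψ x)).1.1 ≠ (false, 0, m) := fun m hm => by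
      obtain ⟨y, hy, hyx⟩ := exists_exchange_of_cell_eq e hm
      have hy' : (F (c m)).symm y ∈ baseSet e := by
        rw [← mem_baseSet_of_fixes (hF (c m)), Homeomorph.apply_symm_apply]
        exact hy
      have h := hψT m _ hy'
      rw [Homeomorph.apply_symm_apply] at h
      have hx' : T m ((F (c m)).symm y) = x := ψ.injective (h.trans hyx)
      refine hx m ?_
      rw [← hx', hT m _ hy']
    rw [hτfix x hx, hτfix _ hψx, hf]
    exact hψx 0

end Action

/-! ### Word lengths -/

section Words

variable {G : Type*} [Group G] {S : Set G} {j k : ℕ} {g g' : G}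

theorem IsWordOfLengthAtMost.of_mem (hg : g ∈ S) : IsWordOfLengthAtMost S 1 g :=
  ⟨[g], by simp, by simp [hg], by simp⟩

theorem IsWordOfLengthAtMost.mono (h : IsWordOfLengthAtMost S j g) (hjk : j ≤ k) :
    IsWordOfLengthAtMost S k g :=
  let ⟨l, hl, hlS, hlg⟩ := h
  ⟨l, hl.trans hjk, hlS, hlg⟩

theorem IsWordOfLengthAtMost.mul (h : IsWordOfLengthAtMost S j g)
    (h' : IsWordOfLengthAtMost S k g') : IsWordOfLengthAtMost S (j + k) (g * g') := by
  obtain ⟨l, hl, hlS, rfl⟩ := h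
  obtain ⟨l', hl', hlS', rfl⟩ := h'
  refine ⟨l ++ l', by simpa using add_le_add hl hl', fun x hx => ?_, List.prod_append⟩
  exact (List.mem_append.1 hx).elim (hlS x) (hlS' x)

theorem IsWordOfLengthAtMost.inv (h : IsWordOfLengthAtMost S k g) :
    IsWordOfLengthAtMost S k g⁻¹ := by
  obtain ⟨l, hl, hlS, rfl⟩ := h
  refine ⟨(l.map fun x => x⁻¹).reverse, by simpa using hl, fun x hx => ?_,
    (List.prod_inv_reverse l).symm⟩
  obtain ⟨y, hy, rfl⟩ := List.mem_map.1 (List.mem_reverse.1 hx)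
  simpa using (hlS y hy).symm

theorem IsWordOfLengthAtMost.pow (h : IsWordOfLengthAtMost S k g) (i : ℕ) :
    IsWordOfLengthAtMost S (k * i) (g ^ i) := by
  induction i with
  | zero => exact ⟨[], by simp, by simp, by simp⟩
  | succ i ih =>
    rw [pow_succ]
    exact (ih.mul h).mono (by rw [mul_add_one])

/-- Two conjugates of length `2 * k + 1` and two letters `τ`. -/
theorem IsWordOfLengthAtMost.conj_commutator {u φ τ : G} (hu : IsWordOfLengthAtMost S k u)
    (hφ : φ ∈ S) (hτ : τ ∈ S) :
    IsWordOfLengthAtMost S (4 * k + 4) ((u⁻¹ * φ * u) * τ * (u⁻¹ * φ * u)⁻¹ * τ⁻¹) := by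
  have hψ := (hu.inv.mul (.of_mem hφ)).mul hu
  exact (((hψ.mul (.of_mem hτ)).mul hψ.inv).mul (IsWordOfLengthAtMost.of_mem hτ).inv).mono
    (by omega)

/-- Having `1` in the set lets shorter words be padded to length exactly `k`. -/
theorem IsWordOfLengthAtMost.mem_pow [DecidableEq G] {S : Finset G}
    (h : IsWordOfLengthAtMost (S : Set G) k g) :
    g ∈ ((insert 1 (S ∪ S⁻¹) : Finset G) : Set G) ^ k := by
  obtain ⟨l, hl, hlS, rfl⟩ := h
  have h₁ : (1 : G) ∈ ((insert 1 (S ∪ S⁻¹) : Finset G) : Set G) := by simp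
  refine Set.pow_subset_pow_right h₁ hl ?_
  clear hl
  induction l with
  | nil => simp
  | cons x l ih =>
    rw [List.prod_cons, List.length_cons, pow_succ']
    refine Set.mul_mem_mul ?_ (ih fun y hy => hlS y (List.mem_cons_of_mem _ hy))
    have := hlS x List.mem_cons_self
    simp only [Finset.mem_coe] at this
    simp [this]

/-- Uniformly bounded words in the elements of sets of bounded size give strong distortion. -/
theorem isStronglyDistorted_of_words {G : Type v} [Group G] (m : ℕ) (w : ℕ+ → ℕ)
    (h : ∀ g : ℕ+ → G, ∃ S : Finset G, S.card = m ∧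
      ∀ n, IsWordOfLengthAtMost (S : Set G) (w n) (g n)) : IsStronglyDistorted G := by
  classical
  refine ⟨m + m + 1, w, fun g => ?_⟩
  obtain ⟨S, hS, hw⟩ := h g
  refine ⟨insert 1 (S ∪ S⁻¹), ?_, fun n => (hw n).mem_pow⟩
  calc (insert 1 (S ∪ S⁻¹)).card ≤ (S ∪ S⁻¹).card + 1 := Finset.card_insert_le _ _
    _ ≤ S.card + S⁻¹.card + 1 := Nat.succ_le_succ (Finset.card_union_le _ _)
    _ = m + m + 1 := by rw [Finset.card_inv, hS]

end Words

/-! ### Distortion for self-similar spaces -/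

/-- If `X` is homeomorphic to `ℕ × X`, and in every partition of `X` into two clopen sets one of
them is homeomorphic to `X`, then every sequence of homeomorphisms of `X` is given by words of
linearly growing length in four homeomorphisms. -/
theorem exists_four_homeomorph_words {X : Type*} [TopologicalSpace X] [Nonempty X]
    (d : X ≃ₜ ℕ × X)
    (hX : ∀ A : Set X, IsClopen A → Nonempty (A ≃ₜ X) ∨ Nonempty ((Aᶜ : Set X) ≃ₜ X))
    (h : ℕ+ → X ≃ₜ X) :
    ∃ S : Finset (X ≃ₜ X), S.card = 4 ∧
      ∀ n : ℕ+, IsWordOfLengthAtMost (S : Set (X ≃ₜ X)) (12 * (n : ℕ) + 18) (h n) := by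
  classical
  obtain ⟨ι⟩ : Nonempty (ℕ ≃ Site) := nonempty_equiv_of_countable
  let e : X ≃ₜ Site × X := d.trans (ι.toHomeomorphOfDiscrete.prodCongr (Homeomorph.refl X))
  obtain ⟨t, ht_row, ht_sq, k₀, ht_fix⟩ := exists_perm_square_into_baseCell
  let C := baseSet e
  have hC : IsClopenCopy C := (isClopenCopy_label e (baseCell, 0)).mono d (isClopen_baseSet e)
    fun x (hx : (e x).1 = _) => by simp [C, baseSet, hx]
  have hC' : IsClopenCopy Cᶜ := (isClopenCopy_label e ((true, 0, 0), 0)).mono d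
    (isClopen_baseSet e).compl fun x (hx : (e x).1 = _) => by simp [C, baseSet, hx, baseCell]
  let s := siteHom e (t * t)
  have hs : ∀ x, x ∉ C → s x ∈ C := fun x hx => by
    simpa [C, s, baseSet, apply_siteHom] using ht_sq _ hx
  have hsC : IsClopenCopy (C ∩ s '' C) := by
    refine (isClopenCopy_label e (baseCell, k₀)).mono d (hC.1.inter (hC.image s).1) ?_
    intro x (hx : (e x).1 = _)
    have hxC : x ∈ C := by simp [C, baseSet, hx]
    exact ⟨hxC, x, hxC, siteHom_eq_self e (by simp [hx, ht_fix])⟩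
  choose f₁ f₂ f₃ hf₁ hf₂ hf₃ hfac using
    fun i : ℕ => exists_factorization d hX hC hC' s hs hsC (h i.succPNat)
  -- On the half-rows `m ≥ 0`: `f₁ i` in lower row `i`, `f₃ i` in lower row `-(i + 1)`, `f₂ i` in
  -- upper row `i + 1`.
  let F : Cell → X ≃ₜ X := fun c =>
    if c.2.2 < 0 then 1
    else if c.1 = true then f₂ (c.2.1 - 1).toNat
    else if 0 ≤ c.2.1 then f₁ c.2.1.toNat
    else f₃ (-c.2.1 - 1).toNat
  have hF : ∀ c x, x ∉ C → F c x = x := fun c x hx => by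
    simp only [F]
    split_ifs
    exacts [rfl, hf₂ _ x hx, hf₁ _ x hx, hf₃ _ x hx]
  obtain ⟨φ, hφ⟩ := exists_cellwise e F hF
  let σ := siteHom e rowShift
  let τ := siteHom e baseRowShift
  -- Infinitude allows padding to exactly four elements should some generators coincide.
  have : Infinite (X ≃ₜ X) := Infinite.of_injective _ (siteHom_injective e)
  obtain ⟨S, hS, hcard⟩ := Infinite.exists_superset_card_eq
    ({φ, σ, τ, siteHom e t} : Finset (X ≃ₜ X)) 4 Finset.card_le_four
  have hφS : φ ∈ (S : Set (X ≃ₜ X)) := hS (by simp)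
  have hτS : τ ∈ (S : Set (X ≃ₜ X)) := hS (by simp)
  have hσ : IsWordOfLengthAtMost (S : Set (X ≃ₜ X)) 1 σ := .of_mem (hS (by simp))
  have ht : IsWordOfLengthAtMost (S : Set (X ≃ₜ X)) 1 (siteHom e t) := .of_mem (hS (by simp))
  have hsw : IsWordOfLengthAtMost (S : Set (X ≃ₜ X)) 2 s := by
    simpa [s] using ht.mul ht
  have hw₁ : ∀ i, IsWordOfLengthAtMost (S : Set (X ≃ₜ X)) (4 * i + 4) (f₁ i) := fun i => by
    rw [eq_commutator_of_cellwise e hF hφ (hf₁ i) (u := rowShift ^ i) (c := fun m => (false, i, m))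
      (by simp [rowShift_pow_apply]) (fun m hm => by simp [F, hm.not_gt])
      (fun m hm => by simp [F, hm])]
    refine IsWordOfLengthAtMost.conj_commutator ?_ hφS hτS
    simpa using hσ.pow i
  have hw₂ : ∀ i, IsWordOfLengthAtMost (S : Set (X ≃ₜ X)) (4 * i + 12) (f₂ i) := fun i => by
    -- The base row goes to lower row `1`, is lifted by `t` to upper row `1`, then shifted to row `1
    -- + i`.
    rw [eq_commutator_of_cellwise e hF hφ (hf₂ i) (u := rowShift ^ i * t * rowShift)
      (c := fun m => (true, 1 + i, m))
      (by simp [rowShift_pow_apply, rowShift_apply, ht_row])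
      (fun m hm => by
        have h₂ : (1 + (i : ℤ) - 1).toNat = i := by omega
        simp only [F, hm.not_gt, h₂, if_false, if_true])
      (fun m hm => by simp [F, hm])]
    refine (IsWordOfLengthAtMost.conj_commutator (k := i + 2) ?_ hφS hτS).mono (by omega)
    simpa [add_assoc] using ((hσ.pow i).mul ht).mul hσ
  have hw₃ : ∀ i, IsWordOfLengthAtMost (S : Set (X ≃ₜ X)) (4 * i + 8) (f₃ i) := fun i => by
    rw [eq_commutator_of_cellwise e hF hφ (hf₃ i) (u := (rowShift ^ (i + 1))⁻¹)
      (c := fun m => (false, 0 - ((i + 1 : ℕ) : ℤ), m))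
      (fun m k => rowShift_pow_inv_apply _ _ _ _ _)
      (fun m hm => by
        have h₁ : ¬ (0 ≤ 0 - ((i + 1 : ℕ) : ℤ)) := by omega
        have h₂ : (-(0 - ((i + 1 : ℕ) : ℤ)) - 1).toNat = i := by omega
        simp only [F, hm.not_gt, h₁, h₂, if_false, Bool.false_eq_true])
      (fun m hm => by simp [F, hm])]
    refine (IsWordOfLengthAtMost.conj_commutator (k := i + 1) ?_ hφS hτS).mono (by omega)
    simpa using (hσ.pow (i + 1)).inv
  refine ⟨S, hcard, fun n => ?_⟩
  obtain ⟨i, rfl⟩ : ∃ i : ℕ, i.succPNat = n := ⟨n.natPred, PNat.succPNat_natPred n⟩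
  -- The length is `12 * i + 28`; a final `s⁻¹` gives `12 * i + 30 = 12 * (i + 1) + 18`.
  have hw := ((hw₁ i).mul ((hsw.mul (hw₂ i)).mul hsw.inv)).mul (hw₃ i)
  rw [Nat.succPNat_coe]
  rcases hfac i with H | H
  · rw [H]
    exact hw.mono (by omega)
  · rw [H]
    exact (hw.mul hsw.inv).mono (by omega)

theorem mainTheorem4 (α : Ordinal.{u}) :
    IsStronglyDistorted (OrdinalHomeo (ω ^ (α + 1))) ∧
    ∀ h : ℕ+ → OrdinalHomeo (ω ^ (α + 1)),
      ∃ S : Finset (OrdinalHomeo (ω ^ (α + 1))), S.card = 4 ∧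
        ∀ n : ℕ+, IsWordOfLengthAtMost (S : Set (OrdinalHomeo (ω ^ (α + 1))))
          (12 * (n : ℕ) + 18) (h n) := by
  have : Nonempty (OrdinalSpace (ω ^ (α + 1))) := ⟨topPoint α 0⟩
  obtain ⟨d⟩ := nonempty_homeomorph_nat_prod_ordinalSpace α
  have H := exists_four_homeomorph_words d fun A hA => hA.nonempty_homeomorph_or_compl
  exact ⟨isStronglyDistorted_of_words 4 (fun n => 12 * (n : ℕ) + 18) H, H⟩
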